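/- Let $n\ge 1$, $1<p<\infty$ and $\frac1p+\frac1{p'}=1$. For a Schwartz function $g\in\mathcal S(\mathbb R^n)$ (complex-valued) let $$\big(\ln\sqrt{-\Delta}\,g\big)(x)=\int_{\mathbb R^n} e^{2\pi i x\cdot\xi}\,\ln(2\pi|\xi|)\,\hat g(\xi)\,d\xi,\qquad \hat g(\xi)=\int_{\mathbb R^n}e^{-2\pi i x\cdot\xi}g(x)\,dx .$$ Then the integrals below, and the integral over $\xi$ that defines $\ln\sqrt{-\Delta}\,g$, converge absolutely, and $$\int_{\mathbb R^n}\ln|x|\,|g|^p\,dx+\operatorname{Re}\int_{\mathbb R^n}\big(\ln\sqrt{-\Delta}\,g\big)\,\overline{g}\,|g|^{p-2}\,dx\;\ge\; D\int_{\mathbb R^n}|g|^p\,dx,$$ $$D=\ln 2+\frac12\Big[\psi\Big(\frac{n}{2p}\Big)+\psi\Big(\frac{n}{2p'}\Big)\Big],\qquad \psi=(\ln\Gamma)',$$ where $\overline g\,|g|^{p-2}$ is read as $0$ where $g=0$. (If $g$ is real-valued, then so is $\ln\sqrt{-\Delta}\,g$, and the second integral is simply $\int(\ln\sqrt{-\Delta}\,g)\,g\,|g|^{p-2}\,dx$.)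 -/

import Mathlib

open MeasureTheory
open scoped SchwartzMap FourierTransform ComplexConjugate

noncomputable section

/-- The operator `Φ(√(-Δ))` on Schwartz functions on `ℝⁿ`. With the normalization
`𝓕 g ξ = ∫ exp(-2πi x·ξ) g(x) dx` the operator `-Δ` is multiplication by `(2π|ξ|)²` on the Fourier
side, so `Φ(√(-Δ))` is the Fourier multiplier with symbol `Φ(2π|ξ|)`:
`(Φ(√(-Δ)) g)(x) = ∫ exp(2πi x·ξ) Φ(2π|ξ|) 𝓕 g ξ dξ`. -/
def funSqrtNegLaplacian {n : ℕ} (Φ : ℝ → ℝ) (g : 𝓢(EuclideanSpace ℝ (Fin n), ℂ)) :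
    EuclideanSpace ℝ (Fin n) → ℂ :=
  𝓕⁻ (fun ξ : EuclideanSpace ℝ (Fin n) =>
    ((Φ (2 * Real.pi * ‖ξ‖) : ℝ) : ℂ) * (𝓕 g) ξ)

/-- The operator `ln √(-Δ)`. -/
def logSqrtNegLaplacian {n : ℕ} (g : 𝓢(EuclideanSpace ℝ (Fin n), ℂ)) :
    EuclideanSpace ℝ (Fin n) → ℂ :=
  funSqrtNegLaplacian Real.log g

/-- The digamma function `ψ = (ln Γ)'` of a positive real variable. -/
def realDigamma (x : ℝ) : ℝ :=
  deriv (fun t : ℝ => Real.log (Real.Gamma t)) x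

/-- The constant `D = ln 2 + (1/2) [ψ(n/(2p)) + ψ(n/(2p'))]`. -/
def logUncertaintyConst (n : ℕ) (p p' : ℝ) : ℝ :=
  Real.log 2 + (1 / 2) * (realDigamma (n / (2 * p)) + realDigamma (n / (2 * p')))

end

/-!
The inequality is the derivative at `ε = 0` of a family of sharp inequalities for the Riesz
potentials `(-Δ)^(-ε)`, `ε > 0`, all of which are equalities at `ε = 0`.

Averaging the heat flow, `Γ(ε) (-Δ)^(-ε) g = ∫₀^∞ t^(ε-1) exp(tΔ) g dt`
(`gamma_mul_rieszPotential`), shows that the Riesz potential has a positive kernel `K`. In the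
pairing of `(-Δ)^(-ε) g` with `conj g |g|^(p-2)` the product `|g(y)| |g(x)|^(p-1)` is estimated by
Young's inequality with weights,
`|g(y)| |g(x)|^(p-1) ≤ |g(y)|^p (|y|/|x|)^(n/p') / p + |g(x)|^p (|x|/|y|)^(n/p) / p'`,
which is an equality for the virtual extremal `|x|^(-n/p)` (`mul_rpow_sub_one_le_of_weights`).
What remains is the action of `K` on the two powers `|x|^(-n/p')` and `|x|^(-n/p)`, and
`(-Δ)^(-ε)` maps `|x|^(-2α)` to an explicit multiple `rieszConst α β ε` of `|x|^(2ε-2α)`, where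
`α + β = n/2` (`lintegral_rpow_mul_lintegral_heatKernel_mul_rpow_norm`). It is computed by writing
the power as a superposition of Gaussians, which the heat flow maps to Gaussians; this leaves a beta integral.
Altogether, with `α = n/(2p)`, `β = n/(2p')`,
`Re ∫ ((-Δ)^(-ε) g) conj g |g|^(p-2) ≤ C(ε) ∫ |x|^(2ε) |g|^p`,
`C = rieszConst β α / p + rieszConst α β / p'`
(`re_integral_rieszPotential_mul_dualFun_le`).

Since `C(0) = 1`, subtracting both sides from `∫ |g|^p` and dividing by `2ε` gives an inequality
between difference quotients. As `ε → 0` the left one tends to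
`-C'(0)/2 ∫ |g|^p - ∫ ln|x| |g|^p`, and `-C'(0)/2 = ln 2 + (ψ(α) + ψ(β))/2`
(`hasDerivAt_rieszConst_zero`); the right one tends to the pairing with `ln √(-Δ) g`. Both limits
are dominated by `r^(1/2) + r^(-1/2)` times a rapidly decreasing function.
-/

open Set Filter Topology

/-! ### Riesz potentials of powers of the norm -/

section RieszConstant

theorem lintegral_rpow_mul_exp_neg_mul_Ioi {c r : ℝ} (hc : 0 < c) (hr : 0 < r) :
    ∫⁻ t in Ioi (0 : ℝ), ENNReal.ofReal (t ^ (c - 1) * Real.exp (-(r * t))) =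
      ENNReal.ofReal (Real.Gamma c * r ^ (-c)) := by
  have key := Real.integral_rpow_mul_exp_neg_mul_Ioi hc hr
  have hpos : 0 < (1 / r) ^ c * Real.Gamma c :=
    mul_pos (Real.rpow_pos_of_pos (by positivity) _) (Real.Gamma_pos_of_pos hc)
  have hint : IntegrableOn (fun t : ℝ => t ^ (c - 1) * Real.exp (-(r * t))) (Ioi 0) :=
    .of_integral_ne_zero (by rw [key]; exact hpos.ne')
  rw [← ofReal_integral_eq_lintegral_ofReal hint, key]
  · rw [one_div, Real.inv_rpow hr.le, Real.rpow_neg hr.le, mul_comm]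
  · filter_upwards [ae_restrict_mem measurableSet_Ioi] with t ht
    exact mul_nonneg (Real.rpow_nonneg (le_of_lt ht) _) (Real.exp_nonneg _)

theorem lintegral_Ioi_comp_mul_left {c : ℝ} (hc : 0 < c) (f : ℝ → ENNReal) :
    ∫⁻ t in Ioi (0 : ℝ), f t = ENNReal.ofReal c * ∫⁻ v in Ioi (0 : ℝ), f (c * v) := by
  have himg : (fun v : ℝ => c * v) '' Ioi 0 = Ioi 0 := by
    rw [Set.image_mul_left_Ioi hc]; simp
  have := lintegral_image_eq_lintegral_abs_deriv_mul (f := fun v : ℝ => c * v)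
    (f' := fun _ => c) (measurableSet_Ioi (a := (0 : ℝ)))
    (fun x _ => by simpa using ((hasDerivAt_id x).const_mul c).hasDerivWithinAt)
    (mul_right_injective₀ hc.ne').injOn f
  rw [himg] at this
  rw [this, abs_of_pos hc, lintegral_const_mul' _ _ ENNReal.ofReal_ne_top]

/-- The beta integral in its form on the half line. -/
theorem lintegral_rpow_mul_one_add_rpow {ε β : ℝ} (hε : 0 < ε) (hβ : 0 < β) :
    ∫⁻ v in Ioi (0 : ℝ), ENNReal.ofReal (v ^ (ε - 1) * (1 + v) ^ (-(β + ε))) =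
      ENNReal.ofReal (Real.Gamma ε * Real.Gamma β / Real.Gamma (β + ε)) := by
  have hG := Real.Gamma_pos_of_pos (add_pos hβ hε)
  have hGε := Real.Gamma_pos_of_pos hε
  have hGβ := Real.Gamma_pos_of_pos hβ
  calc
    _ = ∫⁻ v in Ioi (0 : ℝ), ∫⁻ w in Ioi (0 : ℝ),
        ENNReal.ofReal (Real.Gamma (β + ε))⁻¹ * ENNReal.ofReal
          (v ^ (ε - 1) * (w ^ (β + ε - 1) * Real.exp (-((1 + v) * w)))) := by
      refine setLIntegral_congr_fun measurableSet_Ioi fun v (hv : 0 < v) => ?_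
      have hv' := Real.rpow_nonneg hv.le (ε - 1)
      simp_rw [ENNReal.ofReal_mul hv']
      rw [lintegral_const_mul' _ _ ENNReal.ofReal_ne_top,
        lintegral_const_mul' _ _ ENNReal.ofReal_ne_top,
        lintegral_rpow_mul_exp_neg_mul_Ioi (add_pos hβ hε) (by positivity : 0 < 1 + v),
        ← ENNReal.ofReal_mul hv', ← ENNReal.ofReal_mul hv', ← ENNReal.ofReal_mul (by positivity)]
      congr 1
      field_simp
    _ = ∫⁻ w in Ioi (0 : ℝ), ∫⁻ v in Ioi (0 : ℝ),
        ENNReal.ofReal (Real.Gamma (β + ε))⁻¹ * ENNReal.ofReal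
          (v ^ (ε - 1) * (w ^ (β + ε - 1) * Real.exp (-((1 + v) * w)))) := by
      refine lintegral_lintegral_swap (Measurable.aemeasurable ?_)
      unfold Function.uncurry
      fun_prop
    _ = ∫⁻ w in Ioi (0 : ℝ), ENNReal.ofReal ((Real.Gamma (β + ε))⁻¹ * Real.Gamma ε) *
          ENNReal.ofReal (w ^ (β - 1) * Real.exp (-(1 * w))) := by
      refine setLIntegral_congr_fun measurableSet_Ioi fun w (hw : 0 < w) => ?_
      rw [lintegral_const_mul' _ _ ENNReal.ofReal_ne_top]
      have hw' : 0 ≤ w ^ (β + ε - 1) * Real.exp (-w) := by positivity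
      have : ∀ v : ℝ, v ^ (ε - 1) * (w ^ (β + ε - 1) * Real.exp (-((1 + v) * w))) =
          (w ^ (β + ε - 1) * Real.exp (-w)) * (v ^ (ε - 1) * Real.exp (-(w * v))) := by
        intro v
        rw [show -((1 + v) * w) = -w + -(w * v) by ring, Real.exp_add]
        ring
      simp_rw [this, ENNReal.ofReal_mul hw']
      rw [lintegral_const_mul' _ _ ENNReal.ofReal_ne_top,
        lintegral_rpow_mul_exp_neg_mul_Ioi hε hw, ← ENNReal.ofReal_mul hw',
        ← ENNReal.ofReal_mul (by positivity), ← ENNReal.ofReal_mul (by positivity)]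
      congr 1
      rw [show β + ε - 1 = (β - 1) + ε by ring, Real.rpow_add hw, Real.rpow_neg hw.le, one_mul]
      field_simp
    _ = _ := by
      rw [lintegral_const_mul' _ _ ENNReal.ofReal_ne_top,
        lintegral_rpow_mul_exp_neg_mul_Ioi hβ one_pos, ← ENNReal.ofReal_mul (by positivity)]
      congr 1
      rw [Real.one_rpow]
      field_simp

variable {V : Type*} [NormedAddCommGroup V] [InnerProductSpace ℝ V]

/-- The heat kernel, i.e. the convolution kernel of `exp (t Δ)`. -/
noncomputable def heatKernel (t : ℝ) (z : V) : ℝ :=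
  (4 * Real.pi * t) ^ (-(Module.finrank ℝ V / 2 : ℝ)) * Real.exp (-(‖z‖ ^ 2 / (4 * t)))

theorem heatKernel_nonneg {t : ℝ} (ht : 0 < t) (z : V) : 0 ≤ heatKernel t z := by
  unfold heatKernel; positivity

theorem heatKernel_sub_comm (t : ℝ) (x y : V) : heatKernel t (x - y) = heatKernel t (y - x) := by
  unfold heatKernel; rw [norm_sub_rev]

variable [MeasurableSpace V] [BorelSpace V] [FiniteDimensional ℝ V]

theorem integrable_rexp_neg_mul_sq_norm_add {b : ℝ} (hb : 0 < b) (c : ℝ) (w : V) :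
    Integrable (fun v : V => Real.exp (-b * ‖v‖ ^ 2 + c * inner ℝ w v)) := by
  have := (GaussianFourier.integrable_cexp_neg_mul_sq_norm_add (b := (b : ℂ))
    (by simpa using hb) (c : ℂ) w).re
  refine this.congr (ae_of_all _ fun v => ?_)
  simp only [RCLike.re_to_complex]
  rw [← Complex.exp_ofReal_re]
  push_cast
  rfl

theorem integral_rexp_neg_mul_sq_norm_add {b : ℝ} (hb : 0 < b) (c : ℝ) (w : V) :
    ∫ v : V, Real.exp (-b * ‖v‖ ^ 2 + c * inner ℝ w v) =
      (Real.pi / b) ^ (Module.finrank ℝ V / 2 : ℝ) * Real.exp (c ^ 2 * ‖w‖ ^ 2 / (4 * b)) := by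
  have := GaussianFourier.integral_cexp_neg_mul_sq_norm_add (b := (b : ℂ))
    (by simpa using hb) (c : ℂ) w
  apply Complex.ofReal_injective
  rw [← integral_complex_ofReal]
  push_cast
  rw [this, Complex.ofReal_cpow (by positivity)]
  push_cast
  rfl

/-- The heat flow maps Gaussians to Gaussians. -/
theorem lintegral_heatKernel_mul_gaussian {t s : ℝ} (ht : 0 < t) (hs : 0 < s) (y : V) :
    ∫⁻ x : V, ENNReal.ofReal (heatKernel t (y - x) * Real.exp (-(‖x‖ ^ 2 * s))) =
      ENNReal.ofReal ((1 + 4 * t * s) ^ (-(Module.finrank ℝ V / 2 : ℝ)) *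
        Real.exp (-(‖y‖ ^ 2 / (1 + 4 * t * s) * s))) := by
  set d : ℝ := (Module.finrank ℝ V / 2 : ℝ) with hd
  have hb : 0 < 1 / (4 * t) + s := by positivity
  have h1 : ∀ x : V, heatKernel t (y - x) * Real.exp (-(‖x‖ ^ 2 * s)) =
      ((4 * Real.pi * t) ^ (-d) * Real.exp (-(‖y‖ ^ 2 / (4 * t)))) *
        Real.exp (-(1 / (4 * t) + s) * ‖x‖ ^ 2 + (1 / (2 * t)) * inner ℝ y x) := by
    intro x
    unfold heatKernel
    rw [mul_assoc (_ ^ _), mul_assoc (_ ^ _), ← Real.exp_add, ← Real.exp_add, norm_sub_sq_real,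
      ← hd]
    congr 2
    field_simp
    ring
  simp_rw [h1]
  rw [← ofReal_integral_eq_lintegral_ofReal
    ((integrable_rexp_neg_mul_sq_norm_add hb _ y).const_mul _)
    (ae_of_all _ fun x => by positivity), integral_const_mul,
    integral_rexp_neg_mul_sq_norm_add hb, ← hd]
  congr 1
  have h2 : Real.pi / (1 / (4 * t) + s) = (4 * Real.pi * t) / (1 + 4 * t * s) := by field_simp
  rw [h2, Real.div_rpow (by positivity) (by positivity), Real.rpow_neg (by positivity),
    Real.rpow_neg (by positivity)]
  have h3 : Real.exp (-(‖y‖ ^ 2 / (1 + 4 * t * s) * s)) = Real.exp (-(‖y‖ ^ 2 / (4 * t))) *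
      Real.exp ((1 / (2 * t)) ^ 2 * ‖y‖ ^ 2 / (4 * (1 / (4 * t) + s))) := by
    rw [← Real.exp_add]
    congr 1
    field_simp
    ring
  rw [h3]
  have : (4 * Real.pi * t) ^ d ≠ 0 := (Real.rpow_pos_of_pos (by positivity) _).ne'
  field_simp

/-- The factor by which the Riesz potential `(-Δ)^(-ε)` maps `‖x‖^(-2α)` to `‖x‖^(2ε-2α)` in
dimension `2 (α + β)`. -/
noncomputable def rieszConst (α β ε : ℝ) : ℝ :=
  4 ^ (-ε) * (Real.Gamma β * Real.Gamma (α - ε)) / (Real.Gamma (β + ε) * Real.Gamma α)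

theorem rieszConst_pos {α β ε : ℝ} (hε : 0 < ε) (hεα : ε < α) (hβ : 0 < β) :
    0 < rieszConst α β ε := by
  have h1 := Real.Gamma_pos_of_pos (add_pos hβ hε)
  have h2 := Real.Gamma_pos_of_pos (sub_pos.2 hεα)
  have h3 := Real.Gamma_pos_of_pos hβ
  have h4 := Real.Gamma_pos_of_pos (hε.trans hεα)
  unfold rieszConst
  positivity

theorem lintegral_heatKernel_mul_rpow_norm [Nontrivial V] {α t : ℝ} (hα : 0 < α) (ht : 0 < t)
    (y : V) :
    ∫⁻ x : V, ENNReal.ofReal (heatKernel t (y - x) * ‖x‖ ^ (-(2 * α))) =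
      ENNReal.ofReal (Real.Gamma α)⁻¹ * ∫⁻ s in Ioi (0 : ℝ),
        ENNReal.ofReal (s ^ (α - 1) * ((1 + 4 * t * s) ^ (-(Module.finrank ℝ V / 2 : ℝ)) *
          Real.exp (-(‖y‖ ^ 2 / (1 + 4 * t * s) * s)))) := by
  have hG := Real.Gamma_pos_of_pos hα
  calc
    _ = ∫⁻ x : V, ∫⁻ s in Ioi (0 : ℝ), ENNReal.ofReal (Real.Gamma α)⁻¹ * ENNReal.ofReal
          (s ^ (α - 1) * (heatKernel t (y - x) * Real.exp (-(‖x‖ ^ 2 * s)))) := by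
      refine lintegral_congr_ae ?_
      filter_upwards [compl_mem_ae_iff.2 (measure_singleton (μ := volume) (0 : V))] with x hx
      have hx : 0 < ‖x‖ := norm_pos_iff.2 hx
      have hH := heatKernel_nonneg ht (y - x)
      have : ∀ s : ℝ, s ^ (α - 1) * (heatKernel t (y - x) * Real.exp (-(‖x‖ ^ 2 * s))) =
          heatKernel t (y - x) * (s ^ (α - 1) * Real.exp (-(‖x‖ ^ 2 * s))) := fun s => by ring
      simp_rw [this, ENNReal.ofReal_mul hH]
      rw [lintegral_const_mul' _ _ ENNReal.ofReal_ne_top,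
        lintegral_const_mul' _ _ ENNReal.ofReal_ne_top,
        lintegral_rpow_mul_exp_neg_mul_Ioi hα (by positivity : 0 < ‖x‖ ^ 2),
        ← ENNReal.ofReal_mul hH, ← ENNReal.ofReal_mul hH, ← ENNReal.ofReal_mul (by positivity),
        ← Real.rpow_natCast ‖x‖ 2, ← Real.rpow_mul hx.le]
      congr 1
      push_cast
      rw [show (2 : ℝ) * -α = -(2 * α) by ring]
      field_simp
    _ = ∫⁻ s in Ioi (0 : ℝ), ∫⁻ x : V, ENNReal.ofReal (Real.Gamma α)⁻¹ * ENNReal.ofReal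
          (s ^ (α - 1) * (heatKernel t (y - x) * Real.exp (-(‖x‖ ^ 2 * s)))) := by
      refine lintegral_lintegral_swap (Measurable.aemeasurable ?_)
      unfold Function.uncurry heatKernel
      fun_prop
    _ = _ := by
      rw [← lintegral_const_mul' _ _ ENNReal.ofReal_ne_top]
      refine setLIntegral_congr_fun measurableSet_Ioi fun s (hs : 0 < s) => ?_
      have hs' := Real.rpow_nonneg hs.le (α - 1)
      simp_rw [ENNReal.ofReal_mul hs']
      rw [lintegral_const_mul' _ _ ENNReal.ofReal_ne_top,
        lintegral_const_mul' _ _ ENNReal.ofReal_ne_top,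
        lintegral_heatKernel_mul_gaussian ht hs]

/-- The Riesz potential of a power of the norm, with the Riesz potential written as an integral of
the heat flow. -/
theorem lintegral_rpow_mul_lintegral_heatKernel_mul_rpow_norm [Nontrivial V] {α β ε : ℝ}
    (hβ : 0 < β) (hd : α + β = Module.finrank ℝ V / 2) (hε : 0 < ε) (hεα : ε < α)
    {y : V} (hy : y ≠ 0) :
    ∫⁻ t in Ioi (0 : ℝ), ENNReal.ofReal (t ^ (ε - 1)) *
        ∫⁻ x : V, ENNReal.ofReal (heatKernel t (y - x) * ‖x‖ ^ (-(2 * α))) =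
      ENNReal.ofReal (Real.Gamma ε * rieszConst α β ε * ‖y‖ ^ (2 * ε - 2 * α)) := by
  have hα := hε.trans hεα
  have hy : 0 < ‖y‖ := norm_pos_iff.2 hy
  have hG1 := Real.Gamma_pos_of_pos (add_pos hβ hε)
  have hG2 := Real.Gamma_pos_of_pos (sub_pos.2 hεα)
  have hG3 := Real.Gamma_pos_of_pos hβ
  have hG4 := Real.Gamma_pos_of_pos hα
  have hG5 := Real.Gamma_pos_of_pos hε
  set F : ℝ → ℝ → ℝ := fun t s => t ^ (ε - 1) * (s ^ (α - 1) *
    ((1 + 4 * t * s) ^ (-(α + β)) * Real.exp (-(‖y‖ ^ 2 / (1 + 4 * t * s) * s)))) with hF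
  calc
    _ = ENNReal.ofReal (Real.Gamma α)⁻¹ * ∫⁻ t in Ioi (0 : ℝ), ∫⁻ s in Ioi (0 : ℝ),
          ENNReal.ofReal (F t s) := by
      rw [← lintegral_const_mul' _ _ ENNReal.ofReal_ne_top]
      refine setLIntegral_congr_fun measurableSet_Ioi fun t (ht : 0 < t) => ?_
      have ht' := Real.rpow_nonneg ht.le (ε - 1)
      simp only [hF]
      simp_rw [ENNReal.ofReal_mul ht']
      rw [lintegral_heatKernel_mul_rpow_norm hα ht, ← hd,
        lintegral_const_mul' _ _ ENNReal.ofReal_ne_top, mul_left_comm]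
    _ = ENNReal.ofReal (Real.Gamma α)⁻¹ * ∫⁻ s in Ioi (0 : ℝ), ∫⁻ t in Ioi (0 : ℝ),
          ENNReal.ofReal (F t s) := by
      congr 1
      refine lintegral_lintegral_swap (Measurable.aemeasurable ?_)
      simp only [hF]
      unfold Function.uncurry
      fun_prop
    -- the substitution `t = v / (4 s)` decouples the two variables in `1 + 4 t s`
    _ = ENNReal.ofReal (Real.Gamma α)⁻¹ * ∫⁻ s in Ioi (0 : ℝ), ∫⁻ v in Ioi (0 : ℝ),
          ENNReal.ofReal (1 / (4 * s) * F (1 / (4 * s) * v) s) := by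
      congr 1
      refine setLIntegral_congr_fun measurableSet_Ioi fun s (hs : 0 < s) => ?_
      have hs4 : 0 < 1 / (4 * s) := by positivity
      simp_rw [ENNReal.ofReal_mul hs4.le]
      rw [lintegral_Ioi_comp_mul_left hs4, lintegral_const_mul' _ _ ENNReal.ofReal_ne_top]
    _ = ENNReal.ofReal (Real.Gamma α)⁻¹ * ∫⁻ v in Ioi (0 : ℝ), ∫⁻ s in Ioi (0 : ℝ),
          ENNReal.ofReal (1 / (4 * s) * F (1 / (4 * s) * v) s) := by
      congr 1
      refine lintegral_lintegral_swap (Measurable.aemeasurable ?_)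
      simp only [hF]
      unfold Function.uncurry
      fun_prop
    _ = ENNReal.ofReal (Real.Gamma α)⁻¹ * ∫⁻ v in Ioi (0 : ℝ),
          ENNReal.ofReal (4 ^ (-ε) * Real.Gamma (α - ε) * ‖y‖ ^ (2 * ε - 2 * α)) *
            ENNReal.ofReal (v ^ (ε - 1) * (1 + v) ^ (-(β + ε))) := by
      congr 1
      refine setLIntegral_congr_fun measurableSet_Ioi fun v (hv : 0 < v) => ?_
      have h1 : ∀ s ∈ Ioi (0 : ℝ), ENNReal.ofReal (1 / (4 * s) * F (1 / (4 * s) * v) s) =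
          ENNReal.ofReal (4 ^ (-ε) * (v ^ (ε - 1) * (1 + v) ^ (-(α + β)))) * ENNReal.ofReal
            (s ^ (α - ε - 1) * Real.exp (-(‖y‖ ^ 2 / (1 + v) * s))) := by
        intro s hs
        have hs : 0 < s := hs
        rw [← ENNReal.ofReal_mul (by positivity)]
        congr 1
        simp only [hF]
        rw [show 1 + 4 * (1 / (4 * s) * v) * s = 1 + v by field_simp,
          Real.mul_rpow (by positivity) hv.le, one_div, Real.inv_rpow (by positivity),
          Real.mul_rpow (by positivity) hs.le, Real.rpow_sub_one hs.ne',
          Real.rpow_sub_one hs.ne' (α - ε), Real.rpow_sub hs α ε, Real.rpow_sub_one hs.ne' α,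
          Real.rpow_sub_one (by norm_num : (4 : ℝ) ≠ 0), Real.rpow_neg (by norm_num : (0:ℝ) ≤ 4)]
        have := (Real.rpow_pos_of_pos hs ε).ne'
        field_simp
      rw [setLIntegral_congr_fun measurableSet_Ioi h1,
        lintegral_const_mul' _ _ ENNReal.ofReal_ne_top,
        lintegral_rpow_mul_exp_neg_mul_Ioi (sub_pos.2 hεα) (by positivity),
        ← ENNReal.ofReal_mul (by positivity), ← ENNReal.ofReal_mul (by positivity)]
      congr 1
      rw [Real.div_rpow (by positivity) (by positivity), ← Real.rpow_natCast ‖y‖ 2,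
        ← Real.rpow_mul hy.le, show -(β + ε) = -(α + β) - -(α - ε) by ring,
        Real.rpow_sub (by positivity : 0 < 1 + v)]
      push_cast
      rw [show (2 : ℝ) * -(α - ε) = 2 * ε - 2 * α by ring]
      ring
    _ = _ := by
      rw [lintegral_const_mul' _ _ ENNReal.ofReal_ne_top, lintegral_rpow_mul_one_add_rpow hε hβ,
        ← ENNReal.ofReal_mul (by positivity), ← ENNReal.ofReal_mul (by positivity)]
      congr 1
      unfold rieszConst
      field_simp

end RieszConstant

/-! ### Integrability of Schwartz functions against powers and logarithms -/

section Decay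

theorem abs_log_le_sqrt_add_inv_sqrt {r : ℝ} (hr : 0 ≤ r) :
    |Real.log r| ≤ 4 * (r ^ (1 / 2 : ℝ) + r ^ (-(1 / 2) : ℝ)) := by
  rcases hr.eq_or_lt with rfl | hr
  · norm_num
  set L := Real.log r
  have h1 : r ^ (1 / 2 : ℝ) = Real.exp (L * (1 / 2)) := Real.rpow_def_of_pos hr _
  have h2 : r ^ (-(1 / 2) : ℝ) = Real.exp (L * (-(1 / 2))) := Real.rpow_def_of_pos hr _
  rw [h1, h2]
  have h3 := Real.add_one_le_exp (L * (1 / 2))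
  have h4 := Real.add_one_le_exp (L * (-(1 / 2)))
  have h5 := Real.exp_pos (L * (1 / 2))
  have h6 := Real.exp_pos (L * (-(1 / 2)))
  rw [abs_le]
  constructor <;> linarith

/-- A bound, uniform in `u`, for the difference quotients at `0` of `u ↦ r ^ u`. -/
theorem abs_rpow_sub_one_div_le {r u : ℝ} (hr : 0 < r) (hu : |u| ≤ 1 / 4) :
    |(r ^ u - 1) / u| ≤ 4 * (r ^ (1 / 2 : ℝ) + r ^ (-(1 / 2) : ℝ)) := by
  rcases eq_or_ne u 0 with rfl | hu0
  · simp only [div_zero, abs_zero]; positivity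
  set L := Real.log r
  have h0 : r ^ u = Real.exp (L * u) := Real.rpow_def_of_pos hr _
  have h1 : r ^ (1 / 2 : ℝ) = Real.exp (L * (1 / 2)) := Real.rpow_def_of_pos hr _
  have h2 : r ^ (-(1 / 2) : ℝ) = Real.exp (L * (-(1 / 2))) := Real.rpow_def_of_pos hr _
  have h3 : |Real.exp (L * u) - 1| ≤ |L * u| * Real.exp |L * u| := by
    simpa using Complex.norm_exp_sub_sum_le_norm_mul_exp ((L * u : ℝ) : ℂ) 1 |> fun h => by
      simpa [← Complex.ofReal_exp, ← Complex.ofReal_one, ← Complex.ofReal_sub,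
        Complex.norm_real, -Complex.ofReal_mul] using h
  have h4 : |L * u| ≤ |L| * (1 / 4) := by
    rw [abs_mul]; exact mul_le_mul_of_nonneg_left hu (abs_nonneg _)
  have h5 : |L| ≤ 4 * Real.exp (|L| * (1 / 4)) := by
    have := Real.add_one_le_exp (|L| * (1 / 4)); linarith
  have h6 : Real.exp (|L| * (1 / 2)) ≤ r ^ (1 / 2 : ℝ) + r ^ (-(1 / 2) : ℝ) := by
    rw [h1, h2]
    have h5 := Real.exp_pos (L * (1 / 2))
    have h6 := Real.exp_pos (L * (-(1 / 2)))
    rcases abs_cases L with h | h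
    · rw [h.1]; linarith
    · rw [h.1, show -L * (1 / 2) = L * (-(1 / 2)) by ring]; linarith
  rw [abs_div, div_le_iff₀ (abs_pos.2 hu0), h0]
  calc
    _ ≤ |L * u| * Real.exp |L * u| := h3
    _ = |L| * Real.exp |L * u| * |u| := by rw [abs_mul]; ring
    _ ≤ (4 * Real.exp (|L| * (1 / 4))) * Real.exp (|L| * (1 / 4)) * |u| := by gcongr
    _ = 4 * Real.exp (|L| * (1 / 2)) * |u| := by
      rw [mul_assoc 4, ← Real.exp_add]; ring_nf
    _ ≤ _ := by gcongr

theorem tendsto_rpow_sub_one_div {r : ℝ} (hr : 0 < r) :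
    Tendsto (fun u : ℝ => (r ^ u - 1) / u) (𝓝[≠] 0) (𝓝 (Real.log r)) := by
  have h : HasDerivAt (fun u : ℝ => r ^ u) (Real.log r) 0 := by
    simpa using (hasDerivAt_id (0 : ℝ)).const_rpow hr
  refine (hasDerivAt_iff_tendsto_slope.1 h).congr fun u => ?_
  simp [slope_def_field]

variable {V : Type*} [NormedAddCommGroup V] [NormedSpace ℝ V]

theorem SchwartzMap.exists_norm_le_one_add_norm_rpow (g : 𝓢(V, ℂ)) (K : ℝ) :
    ∃ C, 0 ≤ C ∧ ∀ x, ‖g x‖ ≤ C * (1 + ‖x‖) ^ (-K) := by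
  obtain ⟨k, hk⟩ := exists_nat_ge K
  refine ⟨2 ^ k * (Finset.Iic (k, 0)).sup (fun m => SchwartzMap.seminorm ℝ m.1 m.2) g,
    by positivity, fun x => ?_⟩
  have h := SchwartzMap.one_add_le_sup_seminorm_apply (𝕜 := ℝ) (m := (k, 0)) (k := k) (n := 0)
    le_rfl le_rfl g x
  rw [norm_iteratedFDeriv_zero] at h
  have hx : 1 ≤ 1 + ‖x‖ := by linarith [norm_nonneg x]
  rw [Real.rpow_neg (by positivity), ← div_eq_mul_inv, le_div_iff₀ (by positivity), mul_comm]
  refine le_trans ?_ h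
  gcongr
  rw [← Real.rpow_natCast]
  exact Real.rpow_le_rpow_of_exponent_le hx hk

variable [FiniteDimensional ℝ V] [MeasurableSpace V] [BorelSpace V] [Nontrivial V]

theorem integrable_rpow_norm_mul_one_add_norm_rpow (μ : Measure V) [μ.IsAddHaarMeasure] {β K : ℝ}
    (hβ : -(Module.finrank ℝ V : ℝ) < β) (hK : Module.finrank ℝ V + β < K) :
    Integrable (fun x : V => ‖x‖ ^ β * (1 + ‖x‖) ^ (-K)) μ := by
  have hd : 1 ≤ Module.finrank ℝ V := Module.finrank_pos
  rw [integrable_fun_norm_addHaar μ (f := fun r : ℝ => r ^ β * (1 + r) ^ (-K)),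
    ← Ioc_union_Ioi_eq_Ioi zero_le_one, integrableOn_union]
  set b : ℝ := (Module.finrank ℝ V : ℝ) - 1 + β with hb
  have hpow : ∀ r : ℝ, 0 < r → r ^ (Module.finrank ℝ V - 1) • (r ^ β * (1 + r) ^ (-K)) =
      r ^ b * (1 + r) ^ (-K) := by
    intro r hr
    rw [hb, Real.rpow_add hr, ← Nat.cast_pred (Module.finrank_pos (R := ℝ) (M := V)),
      Real.rpow_natCast, smul_eq_mul]
    ring
  have hm : Measurable fun r : ℝ => r ^ (Module.finrank ℝ V - 1) • (r ^ β * (1 + r) ^ (-K)) := by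
    fun_prop
  constructor
  · have h1 : IntegrableOn (fun r : ℝ => r ^ b) (Ioc 0 1) := by
      rw [← intervalIntegrable_iff_integrableOn_Ioc_of_le zero_le_one]
      exact intervalIntegral.intervalIntegrable_rpow' (by linarith)
    refine h1.mono' hm.aestronglyMeasurable ?_
    filter_upwards [ae_restrict_mem measurableSet_Ioc] with r hr
    have hr0 : 0 < r := hr.1
    rw [hpow r hr0, Real.norm_of_nonneg (by positivity)]
    refine mul_le_of_le_one_right (by positivity) ?_
    exact Real.rpow_le_one_of_one_le_of_nonpos (by linarith) (by linarith)
  · have h1 : IntegrableOn (fun r : ℝ => r ^ (b - K)) (Ioi 1) :=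
      integrableOn_Ioi_rpow_of_lt (by linarith) one_pos
    refine h1.mono' hm.aestronglyMeasurable ?_
    filter_upwards [ae_restrict_mem measurableSet_Ioi] with r hr
    have hr0 : 0 < r := one_pos.trans hr
    rw [hpow r hr0, Real.norm_of_nonneg (by positivity), sub_eq_add_neg, Real.rpow_add hr0 b]
    refine mul_le_mul_of_nonneg_left ?_ (by positivity)
    exact Real.rpow_le_rpow_of_nonpos hr0 (by linarith) (by linarith)

theorem SchwartzMap.integrable_rpow_norm_mul_norm_rpow (μ : Measure V) [μ.IsAddHaarMeasure]
    (g : 𝓢(V, ℂ)) {β q : ℝ}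
    (hβ : -(Module.finrank ℝ V : ℝ) < β) (hq : 0 < q) :
    Integrable (fun x : V => ‖x‖ ^ β * ‖g x‖ ^ q) μ := by
  set K : ℝ := Module.finrank ℝ V + β + 1 with hK
  obtain ⟨C, hC, hg⟩ := g.exists_norm_le_one_add_norm_rpow (K / q)
  refine ((integrable_rpow_norm_mul_one_add_norm_rpow μ hβ
    (by linarith : Module.finrank ℝ V + β < K)).const_mul (C ^ q)).mono' ?_
    (ae_of_all _ fun x => ?_)
  · have := g.continuous.measurable
    exact Measurable.aestronglyMeasurable (by fun_prop)
  · rw [Real.norm_of_nonneg (by positivity)]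
    have h1 : ‖g x‖ ^ q ≤ (C * (1 + ‖x‖) ^ (-(K / q))) ^ q :=
      Real.rpow_le_rpow (norm_nonneg _) (hg x) hq.le
    rw [Real.mul_rpow hC (by positivity), ← Real.rpow_mul (by positivity),
      show -(K / q) * q = -K by field_simp] at h1
    calc
      _ ≤ ‖x‖ ^ β * (C ^ q * (1 + ‖x‖) ^ (-K)) := by gcongr
      _ = _ := by ring

theorem SchwartzMap.integrable_norm_rpow (μ : Measure V) [μ.IsAddHaarMeasure]
    (g : 𝓢(V, ℂ)) {q : ℝ} (hq : 0 < q) : Integrable (fun x : V => ‖g x‖ ^ q) μ := by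
  have hd : (0 : ℝ) < Module.finrank ℝ V := by exact_mod_cast Module.finrank_pos
  simpa using g.integrable_rpow_norm_mul_norm_rpow μ (β := 0) (by linarith) hq

/-- The integrable majorant used in all passages to the limit. -/
theorem SchwartzMap.integrable_sqrt_norm_add_inv_sqrt_norm_mul (μ : Measure V)
    [μ.IsAddHaarMeasure] (g : 𝓢(V, ℂ)) {c q : ℝ} (hc : 0 ≤ c) (hq : 0 < q) :
    Integrable (fun x : V => 4 * ((c * ‖x‖) ^ (1 / 2 : ℝ) + (c * ‖x‖) ^ (-(1 / 2) : ℝ)) *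
      ‖g x‖ ^ q) μ := by
  have hd : (1 : ℝ) ≤ Module.finrank ℝ V := by exact_mod_cast Module.finrank_pos
  have h1 := (g.integrable_rpow_norm_mul_norm_rpow μ (β := 1 / 2) (by linarith) hq).const_mul
    (4 * c ^ (1 / 2 : ℝ))
  have h2 := (g.integrable_rpow_norm_mul_norm_rpow μ (β := -(1 / 2)) (by linarith) hq).const_mul
    (4 * c ^ (-(1 / 2) : ℝ))
  refine (h1.add h2).congr (ae_of_all _ fun x => ?_)
  simp only [Pi.add_apply]
  rw [Real.mul_rpow hc (norm_nonneg _), Real.mul_rpow hc (norm_nonneg _)]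
  ring

end Decay

/-! ### Riesz potentials as averages of the heat flow -/

section RieszPotential

variable {V : Type*} [NormedAddCommGroup V] [InnerProductSpace ℝ V] [FiniteDimensional ℝ V]
  [MeasurableSpace V] [BorelSpace V]

/-- On the Fourier side the heat flow is multiplication by `exp (-t (2π‖ξ‖)²)`. -/
theorem fourierInv_exp_mul_fourier (g : 𝓢(V, ℂ)) {t : ℝ} (ht : 0 < t) (x : V) :
    𝓕⁻ (fun ξ : V => ((Real.exp (-(t * (2 * Real.pi * ‖ξ‖) ^ 2)) : ℝ) : ℂ) * (𝓕 g) ξ) x =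
      ∫ y, (heatKernel t (x - y) : ℂ) * g y := by
  set b : ℝ := 4 * Real.pi ^ 2 * t with hb
  have hb0 : 0 < b := by positivity
  have hbre : 0 < (b : ℂ).re := by simpa using hb0
  set φ : V → ℂ := fun v =>
    Complex.exp (-b * ‖v‖ ^ 2 + 2 * Real.pi * Complex.I * (inner ℝ x v : ℝ)) with hφ
  have hφi : Integrable φ := GaussianFourier.integrable_cexp_neg_mul_sq_norm_add hbre _ x
  -- the Gaussian is moved to the other side by the self-adjointness of the Fourier transform
  have h1 : ∫ ξ, 𝓕 (g : V → ℂ) ξ * φ ξ = ∫ y, g y * 𝓕 φ y := by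
    simpa using! VectorFourier.integral_fourierIntegral_smul_eq_flip (L := innerₗ V)
      Real.continuous_fourierChar continuous_inner g.integrable hφi
  have h2 : ∀ y, 𝓕 φ y = (heatKernel t (x - y) : ℂ) := by
    intro y
    rw [hφ, fourier_gaussian_innerProductSpace' hbre]
    unfold heatKernel
    push_cast
    rw [Complex.ofReal_cpow (by positivity)]
    have e1 : (Real.pi / b : ℂ) = ((4 * Real.pi * t : ℝ) : ℂ)⁻¹ := by
      rw [hb]; push_cast
      have : (Real.pi : ℂ) ≠ 0 := by exact_mod_cast Real.pi_ne_zero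
      have : (t : ℂ) ≠ 0 := by exact_mod_cast ht.ne'
      field_simp
    rw [e1, ← Complex.ofReal_inv, ← Complex.ofReal_natCast, ← Complex.ofReal_ofNat,
      ← Complex.ofReal_div, ← Complex.ofReal_cpow (by positivity), Real.inv_rpow (by positivity),
      ← Real.rpow_neg (by positivity)]
    rw [← Complex.ofReal_cpow (by positivity)]
    congr 2
    · rw [hb]; push_cast
      have : (Real.pi : ℂ) ≠ 0 := by exact_mod_cast Real.pi_ne_zero
      have : (t : ℂ) ≠ 0 := by exact_mod_cast ht.ne'
      field_simp
  simp_rw [h2] at h1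
  rw [Real.fourierInv_eq']
  convert h1 using 1
  · refine integral_congr_ae (ae_of_all _ fun ξ => ?_)
    simp only [hφ, smul_eq_mul, SchwartzMap.fourier_coe]
    rw [Complex.exp_add, hb, real_inner_comm]
    push_cast
    rw [show -((t : ℂ) * (2 * Real.pi * ‖ξ‖) ^ 2) = -(4 * Real.pi ^ 2 * t) * ‖ξ‖ ^ 2 by ring,
      show (2 : ℂ) * Real.pi * (inner ℝ x ξ : ℝ) * Complex.I =
        2 * Real.pi * Complex.I * (inner ℝ x ξ : ℝ) by ring]
    ring
  · simp_rw [mul_comm]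

/-- The Riesz potential `(-Δ)^(-ε) g` of order `2ε`, as a Fourier multiplier. The symbol is
integrable against `𝓕 g`, and the definition meaningful, when `2ε` is less than the dimension. -/
noncomputable def rieszPotential (ε : ℝ) (g : 𝓢(V, ℂ)) : V → ℂ :=
  𝓕⁻ (fun ξ : V => (((2 * Real.pi * ‖ξ‖) ^ (-(2 * ε)) : ℝ) : ℂ) * (𝓕 g) ξ)

variable [Nontrivial V]

theorem integrable_rpow_mul_fourier (g : 𝓢(V, ℂ)) {β : ℝ}
    (hβ : -(Module.finrank ℝ V : ℝ) < β) :
    Integrable (fun ξ : V => (((2 * Real.pi * ‖ξ‖) ^ β : ℝ) : ℂ) * (𝓕 g) ξ) := by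
  have h := ((𝓕 g).integrable_rpow_norm_mul_norm_rpow volume hβ one_pos).const_mul
    ((2 * Real.pi) ^ β)
  have hm := (𝓕 g).continuous.measurable
  refine h.mono' (Measurable.aestronglyMeasurable (by fun_prop)) (ae_of_all _ fun ξ => ?_)
  rw [norm_mul, Complex.norm_real, Real.norm_of_nonneg (by positivity), Real.rpow_one,
    Real.mul_rpow (by positivity) (by positivity), mul_assoc]

/-- The Riesz potential is the average `Γ(ε)⁻¹ ∫ t^(ε-1) exp(tΔ) g dt` of the heat flow. -/
theorem gamma_mul_rieszPotential (g : 𝓢(V, ℂ)) {ε : ℝ} (hε : 0 < ε)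
    (hεd : 2 * ε < Module.finrank ℝ V) (x : V) :
    (Real.Gamma ε : ℂ) * rieszPotential ε g x =
      ∫ t in Ioi (0 : ℝ), ((t ^ (ε - 1) : ℝ) : ℂ) * ∫ y, (heatKernel t (x - y) : ℂ) * g y := by
  set F : V → ℝ → ℂ := fun ξ t =>
    Complex.exp ((2 * Real.pi * (inner ℝ ξ x : ℝ) : ℝ) * Complex.I) *
      (((t ^ (ε - 1) * Real.exp (-((2 * Real.pi * ‖ξ‖) ^ 2 * t)) : ℝ) : ℂ) * (𝓕 g) ξ) with hF
  have hgm := (𝓕 g).continuous.measurable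
  have hFm : Measurable (Function.uncurry F) := by
    simp only [hF]; unfold Function.uncurry
    fun_prop
  have hne : ∀ᵐ ξ : V, ξ ≠ 0 := compl_mem_ae_iff.2 (measure_singleton (μ := volume) (0 : V))
  have hpow : ∀ ξ : V, ξ ≠ 0 → ((2 * Real.pi * ‖ξ‖) ^ 2) ^ (-ε) =
      (2 * Real.pi * ‖ξ‖) ^ (-(2 * ε)) := by
    intro ξ hξ
    rw [← Real.rpow_natCast, ← Real.rpow_mul (by positivity)]
    congr 1; push_cast; ring
  have hFn : ∀ ξ : V, ∀ t ∈ Ioi (0 : ℝ), ‖F ξ t‖ₑ =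
      ENNReal.ofReal (t ^ (ε - 1) * Real.exp (-((2 * Real.pi * ‖ξ‖) ^ 2 * t))) *
        ‖(𝓕 g) ξ‖ₑ := by
    intro ξ t ht
    have ht : 0 < t := ht
    simp only [hF]
    rw [enorm_mul, enorm_mul, ← ofReal_norm, Complex.norm_exp_ofReal_mul_I,
      ENNReal.ofReal_one, one_mul, ← ofReal_norm ((_ : ℝ) : ℂ), Complex.norm_real,
      Real.norm_of_nonneg (by positivity)]
  have hint : Integrable (Function.uncurry F)
      ((volume : Measure V).prod (volume.restrict (Ioi (0 : ℝ)))) := by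
    refine ⟨hFm.aestronglyMeasurable, ?_⟩
    rw [hasFiniteIntegral_iff_enorm, lintegral_prod _ hFm.enorm.aemeasurable]
    have h := ((integrable_rpow_mul_fourier g (β := -(2 * ε)) (by linarith)).const_mul
      (Real.Gamma ε : ℂ)).2
    rw [hasFiniteIntegral_iff_enorm] at h
    refine lt_of_le_of_lt (lintegral_mono_ae ?_) h
    filter_upwards [hne] with ξ hξ
    have hξ0 := norm_pos_iff.2 hξ
    have hG := Real.Gamma_pos_of_pos hε
    simp only [Function.uncurry_apply_pair]
    rw [setLIntegral_congr_fun measurableSet_Ioi (hFn ξ), lintegral_mul_const' _ _ enorm_ne_top,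
      lintegral_rpow_mul_exp_neg_mul_Ioi hε (by positivity), hpow ξ hξ, ← mul_assoc, enorm_mul,
      ← Complex.ofReal_mul, ← ofReal_norm ((_ : ℝ) : ℂ), Complex.norm_real,
      Real.norm_of_nonneg (by positivity)]
  calc
    _ = ∫ ξ : V, ∫ t in Ioi (0 : ℝ), F ξ t := by
      rw [rieszPotential, Real.fourierInv_eq', ← integral_const_mul]
      refine integral_congr_ae ?_
      filter_upwards [hne] with ξ hξ
      have hξ0 := norm_pos_iff.2 hξ
      simp only [hF]
      rw [integral_const_mul, integral_mul_const, integral_complex_ofReal,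
        Real.integral_rpow_mul_exp_neg_mul_Ioi hε (by positivity), one_div,
        Real.inv_rpow (by positivity), ← Real.rpow_neg (by positivity), hpow ξ hξ, smul_eq_mul]
      push_cast
      ring
    _ = ∫ t in Ioi (0 : ℝ), ∫ ξ : V, F ξ t := integral_integral_swap hint
    _ = _ := by
      refine setIntegral_congr_fun measurableSet_Ioi fun t (ht : 0 < t) => ?_
      simp only [hF]
      rw [← fourierInv_exp_mul_fourier g ht, Real.fourierInv_eq', ← integral_const_mul]
      refine integral_congr_ae (ae_of_all _ fun ξ => ?_)
      simp only [smul_eq_mul]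
      rw [mul_comm t]
      push_cast
      ring

theorem enorm_gamma_mul_rieszPotential_le (g : 𝓢(V, ℂ)) {ε : ℝ} (hε : 0 < ε)
    (hεd : 2 * ε < Module.finrank ℝ V) (x : V) :
    ENNReal.ofReal (Real.Gamma ε) * ‖rieszPotential ε g x‖ₑ ≤
      ∫⁻ t in Ioi (0 : ℝ), ENNReal.ofReal (t ^ (ε - 1)) *
        ∫⁻ y, ENNReal.ofReal (heatKernel t (x - y) * ‖g y‖) := by
  have hG := Real.Gamma_pos_of_pos hε
  have h1 : ENNReal.ofReal (Real.Gamma ε) * ‖rieszPotential ε g x‖ₑ =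
      ‖(Real.Gamma ε : ℂ) * rieszPotential ε g x‖ₑ := by
    rw [enorm_mul, ← ofReal_norm (Real.Gamma ε : ℂ), Complex.norm_real,
      Real.norm_of_nonneg hG.le]
  rw [h1, gamma_mul_rieszPotential g hε hεd]
  refine (enorm_integral_le_lintegral_enorm _).trans ?_
  refine setLIntegral_mono' measurableSet_Ioi fun t (ht : 0 < t) => ?_
  rw [enorm_mul, ← ofReal_norm ((_ : ℝ) : ℂ), Complex.norm_real,
      Real.norm_of_nonneg (by positivity)]
  gcongr
  refine (enorm_integral_le_lintegral_enorm _).trans (le_of_eq ?_)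
  refine lintegral_congr fun y => ?_
  rw [← ofReal_norm, norm_mul, Complex.norm_real,
    Real.norm_of_nonneg (heatKernel_nonneg ht _)]

end RieszPotential

/-! ### The sharp Schur test -/

section SteinWeiss

/-- Young's inequality with the weights for which it is an equality at `‖·‖^(-n/p)`; here `r` and
`s` are the norms of the two points, `2β = n/p'` and `2α = n/p`. -/
theorem mul_rpow_sub_one_le_of_weights {p p' : ℝ} (h : p.HolderConjugate p') {α β : ℝ}
    (hαβ : β * p' = α * p) {a b r s : ℝ} (ha : 0 ≤ a) (hb : 0 ≤ b) (hr : 0 < r) (hs : 0 < s) :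
    a * b ^ (p - 1) ≤ p⁻¹ * (a ^ p * s ^ (2 * β) * r ^ (-(2 * β))) +
      p'⁻¹ * (b ^ p * r ^ (2 * α) * s ^ (-(2 * α))) := by
  have hp := h.pos
  have hp' := h.symm.pos
  set w : ℝ := (s / r) ^ (2 * β / p) with hw
  have hw0 : 0 < w := Real.rpow_pos_of_pos (by positivity) _
  have h1 := Real.young_inequality_of_nonneg (mul_nonneg ha hw0.le)
    (mul_nonneg (Real.rpow_nonneg hb (p - 1)) (inv_nonneg.2 hw0.le)) h
  have h2 : a * w * (b ^ (p - 1) * w⁻¹) = a * b ^ (p - 1) := by field_simp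
  have h3 : w ^ p = s ^ (2 * β) * r ^ (-(2 * β)) := by
    rw [hw, ← Real.rpow_mul (by positivity), div_mul_cancel₀ _ hp.ne',
      Real.div_rpow hs.le hr.le, Real.rpow_neg hr.le, div_eq_mul_inv]
  have h4 : (w⁻¹) ^ p' = r ^ (2 * α) * s ^ (-(2 * α)) := by
    rw [hw, ← Real.inv_rpow (by positivity), inv_div, ← Real.rpow_mul (by positivity),
      show 2 * β / p * p' = 2 * α by
        rw [div_mul_eq_mul_div, div_eq_iff hp.ne']; linarith,
      Real.div_rpow hr.le hs.le, Real.rpow_neg hs.le, div_eq_mul_inv]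
  have h5 : (b ^ (p - 1)) ^ p' = b ^ p := by
    rw [← Real.rpow_mul hb, h.sub_one_mul_conj]
  rw [h2, Real.mul_rpow ha hw0.le, Real.mul_rpow (by positivity) (by positivity), h3, h4, h5] at h1
  refine h1.trans (le_of_eq ?_)
  ring

variable {V : Type*} [NormedAddCommGroup V] [InnerProductSpace ℝ V] [FiniteDimensional ℝ V]
  [MeasurableSpace V] [BorelSpace V] [Nontrivial V]

/-- The sharp diagonal Stein–Weiss bound, in the form of a Schur test: the kernel of the Riesz
potential is bounded, through the weighted Young inequality, by its action on the two powers
`‖·‖^(-2β)` and `‖·‖^(-2α)`. -/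
theorem lintegral_heatKernel_pairing_le {p p' : ℝ} (h : p.HolderConjugate p') {α β ε : ℝ}
    (hαβ : β * p' = α * p) (hd : α + β = Module.finrank ℝ V / 2) (hε : 0 < ε) (hεα : ε < α)
    (hεβ : ε < β) {f : V → ℝ} (hf : Measurable f) (hf0 : ∀ x, 0 ≤ f x) :
    ∫⁻ x, ENNReal.ofReal (f x ^ (p - 1)) * ∫⁻ t in Ioi (0 : ℝ), ENNReal.ofReal (t ^ (ε - 1)) *
        ∫⁻ y, ENNReal.ofReal (heatKernel t (x - y) * f y) ≤
      ENNReal.ofReal (Real.Gamma ε * (p⁻¹ * rieszConst β α ε + p'⁻¹ * rieszConst α β ε)) *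
        ∫⁻ x, ENNReal.ofReal (‖x‖ ^ (2 * ε) * f x ^ p) := by
  have hp := h.pos
  have hp' := h.symm.pos
  have hα := hε.trans hεα
  have hβ := hε.trans hεβ
  have hG := Real.Gamma_pos_of_pos hε
  have hC1 := rieszConst_pos hε hεβ hα
  have hC2 := rieszConst_pos hε hεα hβ
  have hne : ∀ᵐ ξ : V, ξ ≠ 0 := compl_mem_ae_iff.2 (measure_singleton (μ := volume) (0 : V))
  set K : V → V → ENNReal := fun x y =>
    ∫⁻ t in Ioi (0 : ℝ), ENNReal.ofReal (t ^ (ε - 1) * heatKernel t (x - y)) with hK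
  have hKm : Measurable (Function.uncurry K) := by
    refine Measurable.lintegral_prod_right' (f := fun q : (V × V) × ℝ =>
      ENNReal.ofReal (q.2 ^ (ε - 1) * heatKernel q.2 (q.1.1 - q.1.2))) ?_
    unfold heatKernel
    fun_prop
  have hKc : ∀ x y, K x y = K y x := fun x y => by simp only [hK, heatKernel_sub_comm]
  -- the integral over `t` of the heat flow of a nonnegative function, as an action of `K`
  have hKint : ∀ (u : V → ℝ), Measurable u → (∀ y, 0 ≤ u y) → ∀ x,
      ∫⁻ t in Ioi (0 : ℝ), ENNReal.ofReal (t ^ (ε - 1)) *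
        ∫⁻ y, ENNReal.ofReal (heatKernel t (x - y) * u y) =
      ∫⁻ y, K x y * ENNReal.ofReal (u y) := by
    intro u hu hu0 x
    calc
      _ = ∫⁻ t in Ioi (0 : ℝ), ∫⁻ y,
          ENNReal.ofReal (t ^ (ε - 1) * heatKernel t (x - y)) * ENNReal.ofReal (u y) := by
        refine setLIntegral_congr_fun measurableSet_Ioi fun t (ht : 0 < t) => ?_
        rw [← lintegral_const_mul' _ _ ENNReal.ofReal_ne_top]
        refine lintegral_congr fun y => ?_
        have hH := heatKernel_nonneg ht (x - y)
        rw [← ENNReal.ofReal_mul (by positivity), ← ENNReal.ofReal_mul (by positivity), mul_assoc]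
      _ = ∫⁻ y, ∫⁻ t in Ioi (0 : ℝ),
          ENNReal.ofReal (t ^ (ε - 1) * heatKernel t (x - y)) * ENNReal.ofReal (u y) := by
        refine lintegral_lintegral_swap (Measurable.aemeasurable ?_)
        unfold Function.uncurry heatKernel
        fun_prop
      _ = _ := by
        refine lintegral_congr fun y => ?_
        rw [lintegral_mul_const' _ _ ENNReal.ofReal_ne_top]
  have hKpow : ∀ {a b : ℝ}, 0 < b → a + b = Module.finrank ℝ V / 2 → ε < a → ∀ {x : V}, x ≠ 0 →
      ∫⁻ y, K x y * ENNReal.ofReal (‖y‖ ^ (-(2 * a))) =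
        ENNReal.ofReal (Real.Gamma ε * rieszConst a b ε * ‖x‖ ^ (2 * ε - 2 * a)) := by
    intro a b hb hab ha x hx
    rw [← hKint _ (by fun_prop) (fun y => by positivity) x]
    exact lintegral_rpow_mul_lintegral_heatKernel_mul_rpow_norm hb hab hε ha hx
  have hpw : ∀ {a : ℝ} {x : V}, x ≠ 0 →
      ‖x‖ ^ (2 * a) * ‖x‖ ^ (2 * ε - 2 * a) = ‖x‖ ^ (2 * ε) := by
    intro a x hx
    rw [← Real.rpow_add (norm_pos_iff.2 hx)]
    congr 1; ring
  -- the two terms of the weighted Young inequality; `T1` is integrated over `x` first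
  set T1 : V → V → ENNReal := fun x y => ENNReal.ofReal (p⁻¹ * (f y ^ p * ‖y‖ ^ (2 * β))) *
    (K x y * ENNReal.ofReal (‖x‖ ^ (-(2 * β)))) with hT1
  set T2 : V → V → ENNReal := fun x y => ENNReal.ofReal (p'⁻¹ * (f x ^ p * ‖x‖ ^ (2 * α))) *
    (K x y * ENNReal.ofReal (‖y‖ ^ (-(2 * α)))) with hT2
  have hT1m : Measurable (Function.uncurry T1) := by
    refine Measurable.mul (Measurable.ennreal_ofReal ?_) (hKm.mul (Measurable.ennreal_ofReal ?_))
      <;> fun_prop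
  have hI1 : ∫⁻ x, ∫⁻ y, T1 x y = ENNReal.ofReal (Real.Gamma ε * (p⁻¹ * rieszConst β α ε)) *
      ∫⁻ x, ENNReal.ofReal (‖x‖ ^ (2 * ε) * f x ^ p) := by
    rw [lintegral_lintegral_swap hT1m.aemeasurable,
      ← lintegral_const_mul' _ _ ENNReal.ofReal_ne_top]
    refine lintegral_congr_ae ?_
    filter_upwards [hne] with y hy
    have hfy := hf0 y
    simp only [hT1]
    rw [lintegral_const_mul' _ _ ENNReal.ofReal_ne_top]
    simp_rw [hKc _ y]
    rw [hKpow hα (by rw [add_comm]; exact hd) hεβ hy, ← ENNReal.ofReal_mul (by positivity),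
      ← ENNReal.ofReal_mul (by positivity), ← hpw (a := β) hy]
    congr 1
    ring
  have hI2 : ∫⁻ x, ∫⁻ y, T2 x y = ENNReal.ofReal (Real.Gamma ε * (p'⁻¹ * rieszConst α β ε)) *
      ∫⁻ x, ENNReal.ofReal (‖x‖ ^ (2 * ε) * f x ^ p) := by
    rw [← lintegral_const_mul' _ _ ENNReal.ofReal_ne_top]
    refine lintegral_congr_ae ?_
    filter_upwards [hne] with x hx
    have hfx := hf0 x
    simp only [hT2]
    rw [lintegral_const_mul' _ _ ENNReal.ofReal_ne_top, hKpow hβ hd hεα hx,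
      ← ENNReal.ofReal_mul (by positivity), ← ENNReal.ofReal_mul (by positivity),
      ← hpw (a := α) hx]
    congr 1
    ring
  clear_value T1 T2 K
  calc
    _ = ∫⁻ x, ∫⁻ y, ENNReal.ofReal (f x ^ (p - 1)) * (K x y * ENNReal.ofReal (f y)) := by
      refine lintegral_congr fun x => ?_
      rw [hKint f hf hf0 x, lintegral_const_mul' _ _ ENNReal.ofReal_ne_top]
    _ ≤ ∫⁻ x, ∫⁻ y, (T1 x y + T2 x y) := by
      refine lintegral_mono_ae ?_
      filter_upwards [hne] with x hx
      refine lintegral_mono_ae ?_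
      filter_upwards [hne] with y hy
      have hx0 := norm_pos_iff.2 hx
      have hy0 := norm_pos_iff.2 hy
      have hfx := hf0 x
      have hfy := hf0 y
      have hY := ENNReal.ofReal_le_ofReal
        (mul_rpow_sub_one_le_of_weights h hαβ hfy hfx hx0 hy0)
      rw [ENNReal.ofReal_mul hfy, ENNReal.ofReal_add (by positivity) (by positivity)] at hY
      have e1 : T1 x y = K x y * ENNReal.ofReal
          (p⁻¹ * (f y ^ p * ‖y‖ ^ (2 * β) * ‖x‖ ^ (-(2 * β)))) := by
        simp only [hT1]
        rw [mul_left_comm, ← ENNReal.ofReal_mul (by positivity)]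
        congr 2; ring
      have e2 : T2 x y = K x y * ENNReal.ofReal
          (p'⁻¹ * (f x ^ p * ‖x‖ ^ (2 * α) * ‖y‖ ^ (-(2 * α)))) := by
        simp only [hT2]
        rw [mul_left_comm, ← ENNReal.ofReal_mul (by positivity)]
        congr 2; ring
      rw [e1, e2, ← mul_add, mul_left_comm, mul_comm (ENNReal.ofReal _) (ENNReal.ofReal (f y))]
      gcongr
    _ = ∫⁻ x, ((∫⁻ y, T1 x y) + ∫⁻ y, T2 x y) := by
      refine lintegral_congr fun x => ?_
      have hm : Measurable (T1 x) := hT1m.comp measurable_prodMk_left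
      rw [lintegral_add_left hm]
    _ = _ := by
      have hm : Measurable fun x => ∫⁻ y, T1 x y := hT1m.lintegral_prod_right'
      rw [lintegral_add_left hm, hI1, hI2, ← add_mul,
        ← ENNReal.ofReal_add (by positivity) (by positivity), mul_add]

end SteinWeiss

/-! ### The derivative of the sharp constant -/

section ConstantDerivative

/-- `Γ' = ψ Γ`. -/
theorem hasDerivAt_Gamma_realDigamma {x : ℝ} (hx : 0 < x) :
    HasDerivAt Real.Gamma (realDigamma x * Real.Gamma x) x := by
  have hd : DifferentiableAt ℝ Real.Gamma x :=
    Real.differentiableAt_Gamma fun m => by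
      have : (0 : ℝ) ≤ m := m.cast_nonneg
      linarith
  have hG := (Real.Gamma_pos_of_pos hx).ne'
  have h := hd.hasDerivAt
  have h2 : realDigamma x = deriv Real.Gamma x / Real.Gamma x := (h.log hG).deriv
  rw [h2, div_mul_cancel₀ _ hG]
  exact h

theorem rieszConst_zero {α β : ℝ} (hα : 0 < α) (hβ : 0 < β) : rieszConst α β 0 = 1 := by
  have h1 := (Real.Gamma_pos_of_pos hα).ne'
  have h2 := (Real.Gamma_pos_of_pos hβ).ne'
  simp [rieszConst, h1, h2]

theorem hasDerivAt_rieszConst_zero {α β : ℝ} (hα : 0 < α) (hβ : 0 < β) :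
    HasDerivAt (rieszConst α β) (-(Real.log 4 + realDigamma α + realDigamma β)) 0 := by
  have hGα := (Real.Gamma_pos_of_pos hα).ne'
  have hGβ := (Real.Gamma_pos_of_pos hβ).ne'
  have h1 : HasDerivAt (fun ε : ℝ => (4 : ℝ) ^ (-ε)) (-Real.log 4) 0 := by
    simpa using (hasDerivAt_neg (0 : ℝ)).const_rpow (by norm_num : (0 : ℝ) < 4)
  have h2 : HasDerivAt (fun ε : ℝ => Real.Gamma (α - ε)) (-(realDigamma α * Real.Gamma α)) 0 := by
    refine HasDerivAt.comp_const_sub α 0 ?_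
    rw [sub_zero]
    exact hasDerivAt_Gamma_realDigamma hα
  have h3 : HasDerivAt (fun ε : ℝ => Real.Gamma (β + ε)) (realDigamma β * Real.Gamma β) 0 := by
    refine HasDerivAt.comp_const_add β 0 ?_
    rw [add_zero]
    exact hasDerivAt_Gamma_realDigamma hβ
  have h4 := (h1.fun_mul (h2.const_mul (Real.Gamma β))).fun_div (h3.mul_const (Real.Gamma α))
    (by simp [hGα, hGβ])
  refine h4.congr_deriv ?_
  simp only [neg_zero, Real.rpow_zero, sub_zero, add_zero]
  field_simp
  ring

end ConstantDerivative

/-! ### Inverse Fourier transforms of integrable functions -/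

section FourierLimit

variable {V : Type*} [NormedAddCommGroup V] [InnerProductSpace ℝ V] [FiniteDimensional ℝ V]
  [MeasurableSpace V] [BorelSpace V]

theorem norm_fourierInv_le_integral_norm (f : V → ℂ) (x : V) : ‖𝓕⁻ f x‖ ≤ ∫ ξ, ‖f ξ‖ := by
  rw [Real.fourierInv_eq']
  refine (norm_integral_le_integral_norm _).trans (le_of_eq ?_)
  refine integral_congr_ae (ae_of_all _ fun ξ => ?_)
  simp only [norm_smul, Complex.norm_exp_ofReal_mul_I, one_mul]

theorem continuous_fourierInv {f : V → ℂ} (hf : Integrable f) : Continuous (𝓕⁻ f) := by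
  have h : Continuous (𝓕 f) :=
    VectorFourier.fourierIntegral_continuous Real.continuous_fourierChar
      (L := innerₗ V) continuous_inner hf
  have h2 : 𝓕⁻ f = fun x => 𝓕 f (-x) := funext fun x => Real.fourierInv_eq_fourier_neg f x
  rw [h2]
  exact h.comp continuous_neg

theorem integrable_fourierInv_mul {f k : V → ℂ} (hf : Integrable f) (hk : Integrable k) :
    Integrable fun x => 𝓕⁻ f x * k x :=
  hk.bdd_mul (continuous_fourierInv hf).aestronglyMeasurable
    (ae_of_all _ fun x => norm_fourierInv_le_integral_norm f x)

/-- Dominated convergence on the Fourier side passes to the pairing with an integrable function. -/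
theorem tendsto_integral_fourierInv_mul {ι : Type*} {l : Filter ι} [l.IsCountablyGenerated]
    {F : ι → V → ℂ} {F₀ k : V → ℂ} {bound : V → ℝ} (hk : Integrable k) (hb : Integrable bound)
    (hF : ∀ᶠ i in l, AEStronglyMeasurable (F i))
    (hFb : ∀ᶠ i in l, ∀ᵐ ξ, ‖F i ξ‖ ≤ bound ξ)
    (hlim : ∀ᵐ ξ, Tendsto (fun i => F i ξ) l (𝓝 (F₀ ξ))) :
    Tendsto (fun i => ∫ x, 𝓕⁻ (F i) x * k x) l (𝓝 (∫ x, 𝓕⁻ F₀ x * k x)) := by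
  refine tendsto_integral_filter_of_dominated_convergence (fun x => (∫ ξ, bound ξ) * ‖k x‖) ?_ ?_
    (hk.norm.const_mul _) ?_
  · filter_upwards [hF, hFb] with i h1 h2
    exact (integrable_fourierInv_mul (hb.mono' h1 h2) hk).aestronglyMeasurable
  · filter_upwards [hF, hFb] with i h1 h2
    refine ae_of_all _ fun x => ?_
    rw [norm_mul]
    gcongr
    exact (norm_fourierInv_le_integral_norm _ _).trans
      (integral_mono_ae (hb.mono' h1 h2).norm hb h2)
  · refine ae_of_all _ fun x => Tendsto.mul_const _ ?_
    simp_rw [Real.fourierInv_eq']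
    refine tendsto_integral_filter_of_dominated_convergence bound ?_ ?_ hb ?_
    · have hc : Continuous fun ξ : V =>
          Complex.exp ((2 * Real.pi * (inner ℝ ξ x : ℝ) : ℝ) * Complex.I) := by fun_prop
      filter_upwards [hF] with i h1
      exact hc.aestronglyMeasurable.smul h1
    · filter_upwards [hFb] with i h2
      filter_upwards [h2] with ξ h
      rwa [norm_smul, Complex.norm_exp_ofReal_mul_I, one_mul]
    · filter_upwards [hlim] with ξ h
      exact h.const_smul _

end FourierLimit

/-! ### The inequality for Riesz potentials and its derivative -/

section Pairing

/-- The duality function `conj g |g|^(p-2)` of `g` in `L^p`. For `p < 2` the factor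
`‖g x‖ ^ (p - 2)` is `0` where `g x = 0`; for every `p` the product vanishes there. -/
noncomputable def dualFun {V : Type*} (p : ℝ) (g : V → ℂ) (x : V) : ℂ :=
  conj (g x) * ((‖g x‖ ^ (p - 2) : ℝ) : ℂ)

theorem norm_dualFun {V : Type*} {p : ℝ} (hp : 1 < p) (g : V → ℂ) (x : V) :
    ‖dualFun p g x‖ = ‖g x‖ ^ (p - 1) := by
  rw [dualFun, norm_mul, RCLike.norm_conj, Complex.norm_real,
    Real.norm_of_nonneg (by positivity)]
  rcases (norm_nonneg (g x)).eq_or_lt with h | h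
  · rw [← h, Real.zero_rpow (show p - 1 ≠ 0 by linarith), zero_mul]
  · rw [show p - 1 = 1 + (p - 2) by ring, Real.rpow_add h, Real.rpow_one]

theorem mul_dualFun {V : Type*} {p : ℝ} (hp : 1 < p) (g : V → ℂ) (x : V) :
    g x * dualFun p g x = ((‖g x‖ ^ p : ℝ) : ℂ) := by
  rw [dualFun, ← mul_assoc, Complex.mul_conj, Complex.normSq_eq_norm_sq, ← Complex.ofReal_mul]
  congr 1
  rcases (norm_nonneg (g x)).eq_or_lt with h | h
  · rw [← h, Real.zero_rpow (show p ≠ 0 by linarith)]; simp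
  · rw [← Real.rpow_natCast, ← Real.rpow_add h]; congr 1; push_cast; ring

variable {V : Type*} [NormedAddCommGroup V] [InnerProductSpace ℝ V] [FiniteDimensional ℝ V]
  [MeasurableSpace V] [BorelSpace V] [Nontrivial V]

theorem integrable_dualFun (g : 𝓢(V, ℂ)) {p : ℝ} (hp : 1 < p) : Integrable (dualFun p g) := by
  have hm := g.continuous.measurable
  refine (g.integrable_norm_rpow volume (sub_pos.2 hp)).mono'
    (Measurable.aestronglyMeasurable ?_) (ae_of_all _ fun x => (norm_dualFun hp g x).le)
  have hc : Measurable fun x => conj (g x) := Complex.continuous_conj.measurable.comp hm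
  unfold dualFun
  fun_prop

theorem re_integral_rieszPotential_mul_dualFun_le (g : 𝓢(V, ℂ)) {p p' : ℝ}
    (h : p.HolderConjugate p') {α β ε : ℝ} (hαβ : β * p' = α * p)
    (hd : α + β = Module.finrank ℝ V / 2) (hε : 0 < ε) (hεα : ε < α) (hεβ : ε < β) :
    (∫ x, rieszPotential ε g x * dualFun p g x).re ≤
      (p⁻¹ * rieszConst β α ε + p'⁻¹ * rieszConst α β ε) *
        ∫ x, ‖x‖ ^ (2 * ε) * ‖g x‖ ^ p := by
  have hp := h.pos
  have hp' := h.symm.pos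
  have hG := Real.Gamma_pos_of_pos hε
  have hC1 := rieszConst_pos hε hεβ (hε.trans hεα)
  have hC2 := rieszConst_pos hε hεα (hε.trans hεβ)
  set C := p⁻¹ * rieszConst β α ε + p'⁻¹ * rieszConst α β ε with hC
  have hC0 : 0 < C := by positivity
  have hJ := g.integrable_rpow_norm_mul_norm_rpow volume (β := 2 * ε)
    (by have : (0 : ℝ) ≤ Module.finrank ℝ V := Nat.cast_nonneg _
        linarith) hp
  have hJ0 : 0 ≤ ∫ x, ‖x‖ ^ (2 * ε) * ‖g x‖ ^ p := integral_nonneg fun x => by positivity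
  have key := lintegral_heatKernel_pairing_le h hαβ hd hε hεα hεβ
    g.continuous.norm.measurable (fun x => norm_nonneg _)
  rw [← ofReal_integral_eq_lintegral_ofReal hJ (ae_of_all _ fun x => by positivity),
    ← ENNReal.ofReal_mul (by positivity)] at key
  have h1 : ENNReal.ofReal (Real.Gamma ε * ‖∫ x, rieszPotential ε g x * dualFun p g x‖) ≤
      ENNReal.ofReal (Real.Gamma ε * C * ∫ x, ‖x‖ ^ (2 * ε) * ‖g x‖ ^ p) := by
    refine le_trans ?_ key
    rw [ENNReal.ofReal_mul hG.le, ofReal_norm]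
    calc
      _ ≤ ENNReal.ofReal (Real.Gamma ε) * ∫⁻ x, ‖rieszPotential ε g x * dualFun p g x‖ₑ := by
        gcongr
        exact enorm_integral_le_lintegral_enorm _
      _ ≤ _ := by
        rw [← lintegral_const_mul' _ _ ENNReal.ofReal_ne_top]
        refine lintegral_mono fun x => ?_
        rw [enorm_mul, ← ofReal_norm (dualFun p g x), norm_dualFun h.lt, ← mul_assoc, mul_comm]
        gcongr
        exact enorm_gamma_mul_rieszPotential_le g hε (by linarith) x
  rw [ENNReal.ofReal_le_ofReal_iff (by positivity), mul_assoc] at h1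
  exact (Complex.re_le_norm _).trans (le_of_mul_le_mul_left h1 hG)

theorem tendsto_integral_norm_rpow_sub_one_div (g : 𝓢(V, ℂ)) {q : ℝ} (hq : 0 < q) :
    Tendsto (fun u : ℝ => ∫ x, (‖x‖ ^ u - 1) / u * ‖g x‖ ^ q) (𝓝[>] 0)
      (𝓝 (∫ x, Real.log ‖x‖ * ‖g x‖ ^ q)) := by
  have hm := g.continuous.measurable
  have hne : ∀ᵐ ξ : V, ξ ≠ 0 := compl_mem_ae_iff.2 (measure_singleton (μ := volume) (0 : V))
  refine tendsto_integral_filter_of_dominated_convergence _ ?_ ?_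
    (g.integrable_sqrt_norm_add_inv_sqrt_norm_mul volume zero_le_one hq) ?_
  · exact Eventually.of_forall fun u => Measurable.aestronglyMeasurable (by fun_prop)
  · filter_upwards [Ioo_mem_nhdsGT (by norm_num : (0 : ℝ) < 1 / 4)] with u hu
    filter_upwards [hne] with x hx
    rw [norm_mul, Real.norm_of_nonneg (by positivity : 0 ≤ ‖g x‖ ^ q), one_mul, Real.norm_eq_abs]
    gcongr
    exact abs_rpow_sub_one_div_le (norm_pos_iff.2 hx) (by rw [abs_of_pos hu.1]; exact hu.2.le)
  · filter_upwards [hne] with x hx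
    exact ((tendsto_rpow_sub_one_div (norm_pos_iff.2 hx)).mono_left
      (nhdsGT_le_nhdsNE 0)).mul_const _

theorem integrable_log_norm_mul_norm_rpow (g : 𝓢(V, ℂ)) {q c : ℝ} (hc : 0 ≤ c) (hq : 0 < q) :
    Integrable fun x : V => Real.log (c * ‖x‖) * ‖g x‖ ^ q := by
  have hm := g.continuous.measurable
  refine (g.integrable_sqrt_norm_add_inv_sqrt_norm_mul volume hc hq).mono'
    (Measurable.aestronglyMeasurable (by fun_prop)) (ae_of_all _ fun x => ?_)
  rw [norm_mul, Real.norm_of_nonneg (by positivity : 0 ≤ ‖g x‖ ^ q), Real.norm_eq_abs]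
  gcongr
  exact abs_log_le_sqrt_add_inv_sqrt (by positivity)

theorem integrable_log_mul_fourier (g : 𝓢(V, ℂ)) :
    Integrable fun ξ : V => ((Real.log (2 * Real.pi * ‖ξ‖) : ℝ) : ℂ) * (𝓕 g) ξ := by
  have hm := (𝓕 g).continuous.measurable
  refine (integrable_log_norm_mul_norm_rpow (𝓕 g) (c := 2 * Real.pi) (by positivity)
    one_pos).norm.mono' (Measurable.aestronglyMeasurable (by fun_prop)) (ae_of_all _ fun ξ => ?_)
  rw [norm_mul, norm_mul, Complex.norm_real, Real.rpow_one, norm_norm]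

/-- `(g - (-Δ)^(-ε) g) / (2ε)` as a Fourier multiplier. -/
theorem fourierInv_rpow_sub_one_div (g : 𝓢(V, ℂ)) {ε : ℝ} (hε : 0 < ε)
    (hεd : 2 * ε < Module.finrank ℝ V) (x : V) :
    𝓕⁻ (fun ξ : V => ((((2 * Real.pi * ‖ξ‖) ^ (-(2 * ε)) - 1) / (-(2 * ε)) : ℝ) : ℂ) *
      (𝓕 g) ξ) x = (2 * ε : ℂ)⁻¹ * (g x - rieszPotential ε g x) := by
  have hi := integrable_rpow_mul_fourier g (β := -(2 * ε)) (by linarith)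
  have hg : g x = 𝓕⁻ ((𝓕 g : 𝓢(V, ℂ)) : V → ℂ) x := by
    have : 𝓕⁻ (𝓕 g) = g := FourierPair.fourierInv_fourier_eq g
    conv_lhs => rw [← this]
    rw [SchwartzMap.fourierInv_coe]
  have hexp : ∀ f : V → ℂ, Integrable f → Integrable fun ξ : V =>
      Complex.exp ((2 * Real.pi * (inner ℝ ξ x : ℝ) : ℝ) * Complex.I) • f ξ := by
    intro f hf
    have hc : Continuous fun ξ : V =>
      Complex.exp ((2 * Real.pi * (inner ℝ ξ x : ℝ) : ℝ) * Complex.I) := by fun_prop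
    refine hf.norm.mono' (hc.aestronglyMeasurable.smul hf.1) (ae_of_all _ fun ξ => ?_)
    rw [norm_smul, Complex.norm_exp_ofReal_mul_I, one_mul]
  rw [hg, rieszPotential, Real.fourierInv_eq', Real.fourierInv_eq', Real.fourierInv_eq',
    ← integral_sub (hexp _ (𝓕 g).integrable) (hexp _ hi), ← integral_const_mul]
  refine integral_congr_ae (ae_of_all _ fun ξ => ?_)
  simp only [smul_eq_mul]
  have : (ε : ℂ) ≠ 0 := by exact_mod_cast hε.ne'
  push_cast
  field_simp
  ring

/-- The logarithmic uncertainty inequality, with `2α = n/p` and `2β = n/p'`. -/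
theorem log_uncertainty (g : 𝓢(V, ℂ)) {p p' : ℝ} (h : p.HolderConjugate p') {α β : ℝ}
    (hα : 0 < α) (hβ : 0 < β) (hαβ : β * p' = α * p) (hd : α + β = Module.finrank ℝ V / 2) :
    (Real.log 2 + 1 / 2 * (realDigamma α + realDigamma β)) * ∫ x : V, ‖g x‖ ^ p ≤
      (∫ x : V, Real.log ‖x‖ * ‖g x‖ ^ p) +
        (∫ x : V, 𝓕⁻ (fun ξ : V => ((Real.log (2 * Real.pi * ‖ξ‖) : ℝ) : ℂ) * (𝓕 g) ξ) x *
          dualFun p g x).re := by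
  have hp := h.pos
  have hne : ∀ᵐ ξ : V, ξ ≠ 0 := compl_mem_ae_iff.2 (measure_singleton (μ := volume) (0 : V))
  have hmF := (𝓕 g).continuous.measurable
  set C : ℝ → ℝ := fun ε => p⁻¹ * rieszConst β α ε + p'⁻¹ * rieszConst α β ε with hC
  have hinv := h.inv_add_inv_eq_one
  have hC0 : C 0 = 1 := by
    simp only [hC]
    rw [rieszConst_zero hα hβ, rieszConst_zero hβ hα, mul_one, mul_one, hinv]
  set D := Real.log 2 + 1 / 2 * (realDigamma α + realDigamma β) with hD
  have hCd : HasDerivAt C (-(2 * D)) 0 := by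
    have h1 := ((hasDerivAt_rieszConst_zero hβ hα).const_mul p⁻¹).fun_add
      ((hasDerivAt_rieszConst_zero hα hβ).const_mul p'⁻¹)
    refine h1.congr_deriv ?_
    have : Real.log 4 = 2 * Real.log 2 := by
      rw [show (4 : ℝ) = 2 ^ 2 by norm_num, Real.log_pow]; norm_num
    rw [show realDigamma α = 2 * D - Real.log 4 - realDigamma β by rw [hD, this]; ring]
    linear_combination (-2 * D) * hinv
  have hCt : Tendsto C (𝓝[>] 0) (𝓝 1) := by
    have := hCd.continuousAt.tendsto
    rw [hC0] at this
    exact this.mono_left nhdsWithin_le_nhds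
  have hCq : Tendsto (fun ε => (1 - C ε) / (2 * ε)) (𝓝[>] 0) (𝓝 D) := by
    have h1 := ((hasDerivAt_iff_tendsto_slope.1 hCd).mono_left (nhdsGT_le_nhdsNE 0)).const_mul
      (-(1 / 2))
    rw [show -(1 / 2) * -(2 * D) = D by ring] at h1
    refine h1.congr fun ε => ?_
    rw [slope_def_field, hC0, sub_zero, mul_comm 2 ε, ← div_div]
    ring
  have htwo : Tendsto (fun ε : ℝ => 2 * ε) (𝓝[>] 0) (𝓝[>] 0) := by
    refine tendsto_nhdsWithin_iff.2 ⟨?_, ?_⟩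
    · have : Tendsto (fun ε : ℝ => 2 * ε) (𝓝 0) (𝓝 (2 * 0)) := (continuous_const_mul 2).tendsto 0
      rw [mul_zero] at this
      exact this.mono_left nhdsWithin_le_nhds
    · filter_upwards [self_mem_nhdsWithin] with ε hε
      exact mul_pos two_pos (mem_Ioi.1 hε)
  have hlow : Tendsto (fun ε => (1 - C ε) / (2 * ε) * (∫ x : V, ‖g x‖ ^ p) -
      C ε * ∫ x : V, (‖x‖ ^ (2 * ε) - 1) / (2 * ε) * ‖g x‖ ^ p) (𝓝[>] 0)
      (𝓝 (D * (∫ x : V, ‖g x‖ ^ p) - 1 * ∫ x : V, Real.log ‖x‖ * ‖g x‖ ^ p)) :=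
    (hCq.mul_const _).sub (hCt.mul ((tendsto_integral_norm_rpow_sub_one_div g hp).comp htwo))
  have hup := (Complex.continuous_re.tendsto _).comp (tendsto_integral_fourierInv_mul
    (l := 𝓝[>] (0 : ℝ))
    (F := fun ε ξ => ((((2 * Real.pi * ‖ξ‖) ^ (-(2 * ε)) - 1) / (-(2 * ε)) : ℝ) : ℂ) * (𝓕 g) ξ)
    (F₀ := fun ξ : V => ((Real.log (2 * Real.pi * ‖ξ‖) : ℝ) : ℂ) * (𝓕 g) ξ)
    (integrable_dualFun g h.lt)
    ((𝓕 g).integrable_sqrt_norm_add_inv_sqrt_norm_mul volume (c := 2 * Real.pi) (by positivity)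
      one_pos)
    (Eventually.of_forall fun ε => Measurable.aestronglyMeasurable (by fun_prop))
    (by
      filter_upwards [Ioo_mem_nhdsGT (by norm_num : (0 : ℝ) < 1 / 8)] with ε hε
      filter_upwards [hne] with ξ hξ
      have hξ0 := norm_pos_iff.2 hξ
      rw [norm_mul, Complex.norm_real, Real.norm_eq_abs, Real.rpow_one]
      gcongr
      refine abs_rpow_sub_one_div_le (by positivity) ?_
      rw [abs_neg, abs_of_pos (by linarith [hε.1])]
      linarith [hε.2])
    (by
      filter_upwards [hne] with ξ hξ
      have hξ0 := norm_pos_iff.2 hξ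
      refine Tendsto.mul_const _ ((Complex.continuous_ofReal.tendsto _).comp ?_)
      refine (tendsto_rpow_sub_one_div (by positivity)).comp (tendsto_nhdsWithin_iff.2 ⟨?_, ?_⟩)
      · have := ((tendsto_nhdsWithin_iff.1 htwo).1).neg
        rwa [neg_zero] at this
      · filter_upwards [self_mem_nhdsWithin] with ε hε
        exact neg_ne_zero.2 (mul_ne_zero two_ne_zero (ne_of_gt hε))))
  have hle := le_of_tendsto_of_tendsto hlow hup (by
    filter_upwards [Ioo_mem_nhdsGT (lt_min hα hβ)] with ε hε
    have hε0 : 0 < ε := hε.1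
    have hεα : ε < α := hε.2.trans_le (min_le_left _ _)
    have hεβ : ε < β := hε.2.trans_le (min_le_right _ _)
    have hεd : 2 * ε < Module.finrank ℝ V := by linarith
    have hR := re_integral_rieszPotential_mul_dualFun_le g h hαβ hd hε0 hεα hεβ
    have hgi := g.integrable_norm_rpow volume hp
    have hJi := g.integrable_rpow_norm_mul_norm_rpow volume (β := 2 * ε) (by linarith) hp
    have hRi : Integrable fun x => rieszPotential ε g x * dualFun p g x :=
      integrable_fourierInv_mul (integrable_rpow_mul_fourier g (by linarith))
        (integrable_dualFun g h.lt)
    have e1 : ∫ x : V, (‖x‖ ^ (2 * ε) - 1) / (2 * ε) * ‖g x‖ ^ p =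
        (2 * ε)⁻¹ * ((∫ x, ‖x‖ ^ (2 * ε) * ‖g x‖ ^ p) - ∫ x, ‖g x‖ ^ p) := by
      rw [← integral_sub hJi hgi, ← integral_const_mul]
      refine integral_congr_ae (ae_of_all _ fun x => ?_)
      simp only
      ring
    have e2 : ∫ x : V, 𝓕⁻ (fun ξ : V => ((((2 * Real.pi * ‖ξ‖) ^ (-(2 * ε)) - 1) / (-(2 * ε)) : ℝ)
          : ℂ) * (𝓕 g) ξ) x * dualFun p g x =
        (((2 * ε)⁻¹ : ℝ) : ℂ) * (((∫ x : V, ‖g x‖ ^ p : ℝ) : ℂ) -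
          ∫ x, rieszPotential ε g x * dualFun p g x) := by
      have hgi' : Integrable fun x => ((‖g x‖ ^ p : ℝ) : ℂ) := hgi.ofReal
      rw [← integral_complex_ofReal, ← integral_sub hgi' hRi, ← integral_const_mul]
      refine integral_congr_ae (ae_of_all _ fun x => ?_)
      simp only
      rw [fourierInv_rpow_sub_one_div g hε0 hεd, ← mul_dualFun h.lt]
      push_cast
      ring
    simp only [Function.comp_apply]
    rw [e1, e2, Complex.re_ofReal_mul, Complex.sub_re, Complex.ofReal_re]
    calc
      _ = (2 * ε)⁻¹ * ((∫ x : V, ‖g x‖ ^ p) - C ε * ∫ x, ‖x‖ ^ (2 * ε) * ‖g x‖ ^ p) := by ring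
      _ ≤ _ := by gcongr)
  linarith

end Pairing

/-- Logarithmic uncertainty. All integrals that occur, including the one that defines
`ln √(-Δ) g`, converge absolutely, and the inequality holds. For complex-valued `g` the second
integral is the real part of the pairing of `ln √(-Δ) g` with `g |g|^(p-2)`; for real-valued `g`
the conjugation is void. -/
theorem corollary2 (n : ℕ) (hn : 0 < n) (p p' : ℝ) (hp : 1 < p) (hpp' : 1 / p + 1 / p' = 1)
    (g : 𝓢(EuclideanSpace ℝ (Fin n), ℂ)) :
    Integrable (fun ξ : EuclideanSpace ℝ (Fin n) =>
        ((Real.log (2 * Real.pi * ‖ξ‖) : ℝ) : ℂ) * (𝓕 g) ξ) volume ∧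
    Integrable (fun x : EuclideanSpace ℝ (Fin n) => Real.log ‖x‖ * ‖g x‖ ^ p) volume ∧
    Integrable (fun x : EuclideanSpace ℝ (Fin n) =>
        logSqrtNegLaplacian g x * (conj (g x) * ((‖g x‖ ^ (p - 2) : ℝ) : ℂ))) volume ∧
    Integrable (fun x : EuclideanSpace ℝ (Fin n) => ‖g x‖ ^ p) volume ∧
    logUncertaintyConst n p p' * ∫ x : EuclideanSpace ℝ (Fin n), ‖g x‖ ^ p ≤
      (∫ x : EuclideanSpace ℝ (Fin n), Real.log ‖x‖ * ‖g x‖ ^ p) +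
        (∫ x : EuclideanSpace ℝ (Fin n),
          logSqrtNegLaplacian g x * (conj (g x) * ((‖g x‖ ^ (p - 2) : ℝ) : ℂ))).re := by
  have h : p.HolderConjugate p' :=
    Real.holderConjugate_iff.2 ⟨hp, by rw [← one_div, ← one_div]; exact hpp'⟩
  have hp0 := h.pos
  have hp'0 := h.symm.pos
  have hn' : (0 : ℝ) < n := by exact_mod_cast hn
  have hfr : Module.finrank ℝ (EuclideanSpace ℝ (Fin n)) = n := finrank_euclideanSpace_fin
  have : Nontrivial (EuclideanSpace ℝ (Fin n)) :=
    Module.nontrivial_of_finrank_pos (R := ℝ) (by rw [hfr]; exact hn)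
  refine ⟨integrable_log_mul_fourier g, ?_,
    integrable_fourierInv_mul (integrable_log_mul_fourier g) (integrable_dualFun g hp),
    g.integrable_norm_rpow volume hp0, ?_⟩
  · simpa using integrable_log_norm_mul_norm_rpow g zero_le_one hp0
  · refine log_uncertainty g h (α := n / (2 * p)) (β := n / (2 * p')) (by positivity)
      (by positivity) (by field_simp) ?_
    rw [hfr]
    have := h.inv_add_inv_eq_one
    calc
      (n : ℝ) / (2 * p) + n / (2 * p') = n / 2 * (p⁻¹ + p'⁻¹) := by field_simp
      _ = _ := by rw [this, mul_one]
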